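/- Let $\pi:Q\to\mathbb R$ be a smooth (locally trivial, finite-dimensional, non-empty) fibre bundle over the time axis with coordinate $t$, with bundle coordinates $(t,q^i)$; let $VQ=\ker dt\subset TQ$ be its vertical tangent bundle and $V^*Q$ the dual bundle of $VQ$, with holonomic coordinates $(t,q^i,p_i)$ and the canonical Poisson bracket $\{f,g\}_V=\partial^if\,\partial_ig-\partial^ig\,\partial_if$, where $\partial_i=\partial/\partial q^i$, $\partial^i=\partial/\partial p_i$. A Hamiltonian form is the pull-back $H=h^*\Xi=p_idq^i-\mathcal H\,dt$ on $V^*Q$ of the Liouville form $\Xi$ of $T^*Q$ by a smooth section $h$ of the projection $T^*Q\to V^*Q$. A reference frame (connection) is a smooth vector field $\Gamma=\partial_t+\Gamma^i\partial_i$ on $Q$ with $\Gamma\rfloor dt=1$ (it need not be complete); its frame Hamiltonian form is $H_\Gamma=p_idq^i-p_i\Gamma^idt$. A Hamiltonian form is non-frame if it is not $H_{\Gamma'}$ for any such $\Gamma'$. A smooth vector field $u=u^t\partial_t+u^i\partial_i$ on $Q$ with $u^t$ constant is a generator of gauge symmetries of $H$ if $\mathbf L_{\widetilde u}H=0$ for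 its canonical lift $\widetilde u=u^t\partial_t+u^i\partial_i-p_j\partial_iu^j\,\partial^i$ onto $V^*Q$. The Noether current of a vertical vector field $u$ is the function $J_u=p_iu^i$ on $V^*Q$. Let $\mathcal A$ be a finite-dimensional (real) Lie algebra of smooth vertical vector fields on $Q\to\mathbb R$, and let $\Gamma$ be a reference frame with $[\Gamma,u]=0$ for all $u\in\mathcal A$. Then: 1. $u\mapsto J_u$ is injective on $\mathcal A$ and $\{J_u,J_v\}_V=J_{[u,v]}$, so the currents form a Lie algebra isomorphic to $\mathcal A$. 2. For every polynomial $C$ in the currents $J_u$, $u\in\mathcal A$ (with real coefficients), such that $\{J_u,C\}_V=0$ for all $u\in\mathcal A$, the form $H_\Gamma-C\,dt$ is a Hamiltonian form and every element of $\mathcal A$ is a generator of gauge symmetries of it. 3. For such a $C$, the form $H_\Gamma-C\,dt$ is a frame Hamiltonian form if and only if $C=J_v$ for some smooth vertical vector field $v$ on $Q$. 4. There is a non-frame Hamiltonian form $H=H_\Gamma-C\,dt$ such that every element of $\mathcal A$ is a generator of gauge symmetries of $H$, where $C$ is a polynomial in the currents as in 2 by which an element of the center of the universal enveloping algebra of the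 Lie algebra of the currents is written. (Here an element $\sum_k c_k\,u_k^{n_k}$ of the enveloping algebra, with $c_k\in\mathbb R$, $u_k\in\mathcal A$, $n_k\ge 0$, is written as the polynomial $\sum_k c_kJ_{u_k}^{n_k}$, i.e. by symmetrization. The element is not required to have order $>1$: the center may consist of scalars only.) -/

import Mathlib

open scoped Manifold ContDiff

noncomputable section

namespace TimeMech

section Geometry

variable {E : Type*} [NormedAddCommGroup E] [NormedSpace ℝ E]
variable {Q : Type*} [TopologicalSpace Q] [ChartedSpace (ℝ × E) Q]

/-- `π : Q → ℝ` is a smooth locally trivial fibre bundle with typical fibre the manifold `M`. -/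
def IsSmoothFibreBundle (M : Type*) [TopologicalSpace M] [ChartedSpace E M] (π : Q → ℝ) : Prop :=
  ∀ t : ℝ, ∃ e : Bundle.Trivialization M π, t ∈ e.baseSet ∧
    ContMDiffOn 𝓘(ℝ, ℝ × E) (𝓘(ℝ, ℝ).prod 𝓘(ℝ, E)) ∞
      (fun q => e q) e.source ∧
    ContMDiffOn (𝓘(ℝ, ℝ).prod 𝓘(ℝ, E)) 𝓘(ℝ, ℝ × E) ∞
      (fun z => e.toOpenPartialHomeomorph.symm z) e.target

/-- A vector field on `Q`, not necessarily smooth. -/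
abbrev VField (E Q : Type*) [NormedAddCommGroup E] [NormedSpace ℝ E]
    [TopologicalSpace Q] [ChartedSpace (ℝ × E) Q] : Type _ :=
  (q : Q) → TangentSpace 𝓘(ℝ, ℝ × E) q

/-- Smoothness of a vector field, as a section of the tangent bundle. -/
def SmoothField [IsManifold 𝓘(ℝ, ℝ × E) ∞ Q] (u : VField E Q) : Prop :=
  ContMDiff 𝓘(ℝ, ℝ × E) 𝓘(ℝ, ℝ × E).tangent ∞
    (fun q => (⟨q, u q⟩ : TangentBundle 𝓘(ℝ, ℝ × E) Q))

/-- The 1-form `dt` on `Q`, that is, the differential of `π : Q → ℝ`. -/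
def dt (π : Q → ℝ) (q : Q) : TangentSpace 𝓘(ℝ, ℝ × E) q →L[ℝ] ℝ :=
  mfderiv 𝓘(ℝ, ℝ × E) 𝓘(ℝ, ℝ) π q

/-- The vertical tangent space `V_q Q`. -/
abbrev VertSpace (π : Q → ℝ) (q : Q) : Submodule ℝ (TangentSpace 𝓘(ℝ, ℝ × E) q) :=
  LinearMap.ker (dt (E := E) π q).toLinearMap

/-- The Legendre bundle `V^*Q`: the points are pairs `(q, α)` with `α` a linear form on `V_q Q`. -/
abbrev VStar (E : Type*) [NormedAddCommGroup E] [NormedSpace ℝ E]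
    {Q : Type*} [TopologicalSpace Q] [ChartedSpace (ℝ × E) Q] (π : Q → ℝ) : Type _ :=
  Σ q : Q, (VertSpace (E := E) π q →L[ℝ] ℝ)

/-- A chart of the smooth manifold `Q` which is adapted to the fibration: bundle coordinates
`(t, q^i)` in which `π` is the coordinate `t`. -/
structure IsBundleChart (π : Q → ℝ) (φ : OpenPartialHomeomorph Q (ℝ × E)) : Prop where
  smooth : φ ∈ IsManifold.maximalAtlas 𝓘(ℝ, ℝ × E) ∞ Q
  fst_eq : ∀ q ∈ φ.source, (φ q).1 = π q

/-- The differential of a chart at the point with coordinates `y`. -/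
def chartDiff (φ : OpenPartialHomeomorph Q (ℝ × E)) (y : ℝ × E) :
    TangentSpace 𝓘(ℝ, ℝ × E) (φ.symm y) →L[ℝ] ℝ × E :=
  mfderiv 𝓘(ℝ, ℝ × E) 𝓘(ℝ, ℝ × E) φ (φ.symm y)

/-- The differential of the inverse of a chart at the point with coordinates `y`. -/
def chartSymmDiff (φ : OpenPartialHomeomorph Q (ℝ × E)) (y : ℝ × E) :
    ℝ × E →L[ℝ] TangentSpace 𝓘(ℝ, ℝ × E) (φ.symm y) :=
  mfderiv 𝓘(ℝ, ℝ × E) 𝓘(ℝ, ℝ × E) φ.symm y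

/-- The coordinate space of the holonomic coordinates `((t, q^i), p_i)` on `V^*Q`. -/
abbrev PhaseModel (E : Type*) [NormedAddCommGroup E] [NormedSpace ℝ E] : Type _ :=
  (ℝ × E) × (E →L[ℝ] ℝ)

/-- The range of the holonomic coordinates on `V^*Q` over a chart of `Q`. -/
def phaseTarget (φ : OpenPartialHomeomorph Q (ℝ × E)) : Set (PhaseModel E) :=
  φ.target ×ˢ Set.univ

/-- The point `p_i dq^i` of `V^*Q` with holonomic coordinates `w = ((t, q^i), p_i)`. -/
def ofCoords (π : Q → ℝ) (φ : OpenPartialHomeomorph Q (ℝ × E)) (w : PhaseModel E) : VStar E π :=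
  ⟨φ.symm w.1,
    ((w.2 ∘L ContinuousLinearMap.snd ℝ ℝ E) ∘L chartDiff φ w.1) ∘L
      (VertSpace (E := E) π (φ.symm w.1)).subtypeL⟩

/-- The `q`-part of the differential of a function of `((t, q^i), p_i)`. -/
def dPosition (F : PhaseModel E → ℝ) (w : PhaseModel E) : E →L[ℝ] ℝ :=
  (fderiv ℝ F w) ∘L (ContinuousLinearMap.inl ℝ (ℝ × E) (E →L[ℝ] ℝ)) ∘L
    (ContinuousLinearMap.inr ℝ ℝ E)

/-- The canonical bracket `∂^i F ∂_i G - ∂^i G ∂_i F`, where `∂_i = ∂/∂q^i` and `∂^i = ∂/∂p_i`. -/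
def coordBracket (F G : PhaseModel E → ℝ) (w : PhaseModel E) : ℝ :=
  fderiv ℝ F w (0, dPosition G w) - fderiv ℝ G w (0, dPosition F w)

/-- `k = {f, g}_V` for the canonical Poisson structure on `V^*Q`. -/
def IsPoissonBracket (π : Q → ℝ) (f g k : VStar E π → ℝ) : Prop :=
  ∀ φ : OpenPartialHomeomorph Q (ℝ × E), IsBundleChart π φ → ∀ w ∈ phaseTarget φ,
    coordBracket (fun w' => f (ofCoords π φ w')) (fun w' => g (ofCoords π φ w')) w
      = k (ofCoords π φ w)

/-- A map `h` which sends a point of `V^*Q` over `q` to a covector of `Q` at `q`. It stands for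
the 1-form `h^*Ξ` on `V^*Q`, where `Ξ` is the Liouville form: the value of `h^*Ξ` at the point `x`
on a tangent vector `w` of `V^*Q` is `h x` applied to the projection of `w` to `Q`. -/
abbrev CovectorMap (E : Type*) [NormedAddCommGroup E] [NormedSpace ℝ E]
    {Q : Type*} [TopologicalSpace Q] [ChartedSpace (ℝ × E) Q] (π : Q → ℝ) : Type _ :=
  (x : VStar E π) → (TangentSpace 𝓘(ℝ, ℝ × E) x.1 →L[ℝ] ℝ)

/-- The 1-form `h^*Ξ` on `V^*Q` in holonomic coordinates. -/
def coordForm (π : Q → ℝ) (h : CovectorMap E π) (φ : OpenPartialHomeomorph Q (ℝ × E))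
    (w : PhaseModel E) : PhaseModel E →L[ℝ] ℝ :=
  ((h (ofCoords π φ w)) ∘L chartSymmDiff φ w.1) ∘L
    ContinuousLinearMap.fst ℝ (ℝ × E) (E →L[ℝ] ℝ)

/-- `h^*Ξ` is a Hamiltonian form: `h` is a smooth section of the projection `T^*Q → V^*Q`, which
restricts covectors to vertical vectors. -/
structure IsHamiltonianForm (π : Q → ℝ) (h : CovectorMap E π) : Prop where
  isSection : ∀ (x : VStar E π) (v : VertSpace (E := E) π x.1), h x v = x.2 v
  smooth : ∀ φ : OpenPartialHomeomorph Q (ℝ × E), IsBundleChart π φ →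
    ContDiffOn ℝ ∞ (coordForm π h φ) (phaseTarget φ)

/-- The coordinate expression of a vector field on `Q`. -/
def coordField (φ : OpenPartialHomeomorph Q (ℝ × E)) (u : VField E Q) (y : ℝ × E) : ℝ × E :=
  chartDiff φ y (u (φ.symm y))

/-- The canonical lift `u^t ∂_t + u^i ∂_i - p_j ∂_i u^j ∂^i` onto `V^*Q` of the vector field
`u^t ∂_t + u^i ∂_i`, in holonomic coordinates. -/
def coordLift (φ : OpenPartialHomeomorph Q (ℝ × E)) (u : VField E Q) (w : PhaseModel E) :
    PhaseModel E :=
  (coordField φ u w.1,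
    -(((w.2 ∘L ContinuousLinearMap.snd ℝ ℝ E) ∘L fderiv ℝ (coordField φ u) w.1) ∘L
      ContinuousLinearMap.inr ℝ ℝ E))

/-- The Lie derivative `L_X η` of a 1-form `η` along a vector field `X` on a normed space. -/
def lieDerivForm {W : Type*} [NormedAddCommGroup W] [NormedSpace ℝ W] (X : W → W)
    (η : W → (W →L[ℝ] ℝ)) (w : W) : W →L[ℝ] ℝ :=
  fderiv ℝ η w (X w) + (η w) ∘L (fderiv ℝ X w)

/-- `u` is a generator of gauge symmetries of `H = h^*Ξ`: a smooth vector field on `Q` with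
`u ⌋ dt = const`, such that the Lie derivative of `H` along the canonical lift of `u` onto `V^*Q`
vanishes. -/
structure IsGaugeSymmetry [IsManifold 𝓘(ℝ, ℝ × E) ∞ Q] (π : Q → ℝ) (h : CovectorMap E π) (u : VField E Q) : Prop where
  smooth : SmoothField u
  const : ∃ c : ℝ, ∀ q, dt (E := E) π q (u q) = c
  invariant : ∀ φ : OpenPartialHomeomorph Q (ℝ × E), IsBundleChart π φ → ∀ w ∈ phaseTarget φ,
    lieDerivForm (coordLift φ u) (coordForm π h φ) w = 0

/-- A connection on `Q → ℝ`, i.e. a smooth vector field `Γ` with `Γ ⌋ dt = 1`. -/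
structure ReferenceFrame (E : Type*) [NormedAddCommGroup E] [NormedSpace ℝ E]
    {Q : Type*} [TopologicalSpace Q] [ChartedSpace (ℝ × E) Q]
    [IsManifold 𝓘(ℝ, ℝ × E) ∞ Q] (π : Q → ℝ) where
  field : VField E Q
  smooth : SmoothField field
  dt_eq : ∀ q, dt (E := E) π q (field q) = 1

/-- The projection `v ↦ v - (v ⌋ dt) Γ` of tangent vectors onto vertical ones. -/
def ReferenceFrame.vert [IsManifold 𝓘(ℝ, ℝ × E) ∞ Q] {π : Q → ℝ} (Γ : ReferenceFrame E π) (q : Q) :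
    TangentSpace 𝓘(ℝ, ℝ × E) q →L[ℝ] VertSpace (E := E) π q :=
  (ContinuousLinearMap.id ℝ (TangentSpace 𝓘(ℝ, ℝ × E) q)
    - (dt (E := E) π q).smulRight (Γ.field q)).codRestrict _ (by
      intro v
      have h := Γ.dt_eq q
      simp only [LinearMap.mem_ker, ContinuousLinearMap.coe_coe, sub_apply,
        map_sub]
      change dt π q v - dt π q (dt π q v • Γ.field q) = 0
      rw [map_smul, h]
      simp)

/-- The frame Hamiltonian form `H_Γ = p_i dq^i - p_i Γ^i dt`, defined by the section
`α ↦ α ∘ (id - dt ⊗ Γ)` of `T^*Q → V^*Q`. -/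
def frameForm [IsManifold 𝓘(ℝ, ℝ × E) ∞ Q] {π : Q → ℝ} (Γ : ReferenceFrame E π) : CovectorMap E π :=
  fun x => x.2 ∘L Γ.vert x.1

/-- The form `H_Γ - f dt`. -/
def shiftedFrameForm [IsManifold 𝓘(ℝ, ℝ × E) ∞ Q] {π : Q → ℝ} (Γ : ReferenceFrame E π) (f : VStar E π → ℝ) :
    CovectorMap E π :=
  fun x => frameForm Γ x - f x • dt (E := E) π x.1

/-- `h^*Ξ` is the frame Hamiltonian form of some connection on `Q → ℝ`. -/
def IsFrameForm [IsManifold 𝓘(ℝ, ℝ × E) ∞ Q] (π : Q → ℝ) (h : CovectorMap E π) : Prop :=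
  ∃ Γ : ReferenceFrame E π, h = frameForm Γ

/-- The Noether current `J_u (α) = α (u)` of a vertical vector field `u`. -/
def current {π : Q → ℝ} (u : VField E Q) (hu : ∀ q, u q ∈ VertSpace (E := E) π q) :
    VStar E π → ℝ :=
  fun x => x.2 ⟨u x.1, hu x.1⟩

/-- A Lie algebra of smooth vertical vector fields on `Q → ℝ`. -/
structure VerticalLieAlgebra (E : Type*) [NormedAddCommGroup E] [NormedSpace ℝ E]
    {Q : Type*} [TopologicalSpace Q] [ChartedSpace (ℝ × E) Q]
    [IsManifold 𝓘(ℝ, ℝ × E) ∞ Q] (π : Q → ℝ) where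
  carrier : Submodule ℝ (VField E Q)
  smooth : ∀ u ∈ carrier, SmoothField u
  vertical : ∀ u ∈ carrier, ∀ q, u q ∈ VertSpace (E := E) π q
  lie_mem : ∀ u ∈ carrier, ∀ v ∈ carrier,
    VectorField.mlieBracket 𝓘(ℝ, ℝ × E) u v ∈ carrier

end Geometry

section Algebra

variable {E : Type*} [NormedAddCommGroup E] [NormedSpace ℝ E] [FiniteDimensional ℝ E]
variable {Q : Type*} [TopologicalSpace Q] [ChartedSpace (ℝ × E) Q]
  [IsManifold 𝓘(ℝ, ℝ × E) ∞ Q]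

theorem SmoothField.mdifferentiableAt {u : VField E Q} (hu : SmoothField u) (q : Q) :
    MDifferentiableAt 𝓘(ℝ, ℝ × E) 𝓘(ℝ, ℝ × E).tangent
      (fun q => (⟨q, u q⟩ : TangentBundle 𝓘(ℝ, ℝ × E) Q)) q :=
  (hu q).mdifferentiableAt (by simp)

/-- The Lie ring structure given by the Lie bracket of vector fields. -/
instance (π : Q → ℝ) (𝒜 : VerticalLieAlgebra E π) : LieRing 𝒜.carrier where
  bracket u v := ⟨VectorField.mlieBracket 𝓘(ℝ, ℝ × E) u.1 v.1, 𝒜.lie_mem _ u.2 _ v.2⟩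
  add_lie u v w := by
    have : CompleteSpace (ℝ × E) := FiniteDimensional.complete ℝ _
    have : IsManifold 𝓘(ℝ, ℝ × E) 2 Q := IsManifold.of_le (n := ∞) ENat.LEInfty.out
    apply Subtype.ext
    funext q
    exact VectorField.mlieBracket_add_left ((𝒜.smooth _ u.2).mdifferentiableAt q)
      ((𝒜.smooth _ v.2).mdifferentiableAt q)
  lie_add u v w := by
    have : CompleteSpace (ℝ × E) := FiniteDimensional.complete ℝ _
    have : IsManifold 𝓘(ℝ, ℝ × E) 2 Q := IsManifold.of_le (n := ∞) ENat.LEInfty.out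
    apply Subtype.ext
    funext q
    exact VectorField.mlieBracket_add_right ((𝒜.smooth _ v.2).mdifferentiableAt q)
      ((𝒜.smooth _ w.2).mdifferentiableAt q)
  lie_self u := by
    apply Subtype.ext
    exact VectorField.mlieBracket_self
  leibniz_lie u v w := by
    have : CompleteSpace (ℝ × E) := FiniteDimensional.complete ℝ _
    have : IsManifold 𝓘(ℝ, ℝ × E) (minSmoothness ℝ 3) Q := by
      rw [minSmoothness_of_isRCLikeNormedField]
      exact IsManifold.of_le (n := ∞) ENat.LEInfty.out
    have key : ∀ x : 𝒜.carrier, ContMDiff 𝓘(ℝ, ℝ × E) 𝓘(ℝ, ℝ × E).tangent (minSmoothness ℝ 2)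
        (fun q => (⟨q, x.1 q⟩ : TangentBundle 𝓘(ℝ, ℝ × E) Q)) := by
      intro x
      rw [minSmoothness_of_isRCLikeNormedField]
      exact (𝒜.smooth _ x.2).of_le ENat.LEInfty.out
    apply Subtype.ext
    exact VectorField.leibniz_identity_mlieBracket (key u) (key v) (key w)

/-- The real Lie algebra structure given by the Lie bracket of vector fields. -/
instance (π : Q → ℝ) (𝒜 : VerticalLieAlgebra E π) : LieAlgebra ℝ 𝒜.carrier where
  lie_smul c u v := by
    have : CompleteSpace (ℝ × E) := FiniteDimensional.complete ℝ _
    have : IsManifold 𝓘(ℝ, ℝ × E) 2 Q := IsManifold.of_le (n := ∞) ENat.LEInfty.out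
    apply Subtype.ext
    funext q
    exact VectorField.mlieBracket_const_smul_right ((𝒜.smooth _ v.2).mdifferentiableAt q)

/-- The Noether current `J_u` of an element `u` of the Lie algebra `𝒜`. -/
def VerticalLieAlgebra.J {π : Q → ℝ} (𝒜 : VerticalLieAlgebra E π) (u : 𝒜.carrier) :
    VStar E π → ℝ :=
  current u.1 (𝒜.vertical u.1 u.2)

/-- The graph of the symmetrization correspondence between the universal enveloping algebra and
the polynomials in the currents: it consists of the pairs
`(∑ k, c k • (u k) ^ n k, ∑ k, c k • (J_(u k)) ^ n k)`. If `(C, f)` belongs to it, then `f` is the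
polynomial in the currents `J_u` by which the element `C` is written. -/
def VerticalLieAlgebra.symmetrization {π : Q → ℝ} (𝒜 : VerticalLieAlgebra E π) :
    Submodule ℝ (UniversalEnvelopingAlgebra ℝ 𝒜.carrier × (VStar E π → ℝ)) :=
  Submodule.span ℝ (Set.range fun z : 𝒜.carrier × ℕ =>
    (UniversalEnvelopingAlgebra.ι ℝ z.1 ^ z.2, 𝒜.J z.1 ^ z.2))

/-- The central polynomials in the currents: the elements of the associative subalgebra of
functions on `V^*Q` generated by the currents which Poisson commute with all the currents. -/
def VerticalLieAlgebra.IsPoissonCentral {π : Q → ℝ} (𝒜 : VerticalLieAlgebra E π)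
    (f : VStar E π → ℝ) : Prop :=
  f ∈ Algebra.adjoin ℝ (Set.range 𝒜.J) ∧ ∀ u : 𝒜.carrier, IsPoissonBracket π (𝒜.J u) f 0

end Algebra

end TimeMech

end

open scoped Manifold ContDiff

noncomputable section

namespace TimeMech

/-! In bundle coordinates the current is `J_u = p_i u^i`, and bracketing with it is differentiation
along the canonical lift of the vertical field `u` (`coordBracket_pairing_left`). So a polynomial
`C` Poisson commutes with all currents exactly when it is invariant under all lifts; applied to
another current, this derivative is `J_[u,v]`.

Since `u` is vertical and its lift preserves `p_i dq^i - p_i Γ^i dt` as soon as `[Γ, u] = 0`, the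
Lie derivative of `H_Γ - C dt` is just minus the derivative of `C` along the lift, times `dt`. Hence
central polynomials give gauge-invariant forms (`lieDerivForm_shiftedFrameForm`).

Two frames differ by a vertical field `v`, and `H_(Γ+v) = H_Γ - J_v dt`; this identifies the frame
forms among the `H_Γ - C dt` (`isFrameForm_shiftedFrameForm_iff`). A current vanishes at zero
momenta, so `C = 1`, the unit of the enveloping algebra, already gives a non-frame form. -/

theorem mlieBracket_eq_lieBracket {F : Type*} [NormedAddCommGroup F] [NormedSpace ℝ F]
    (V W : (x : F) → TangentSpace 𝓘(ℝ, F) x) :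
    VectorField.mlieBracket 𝓘(ℝ, F) V W = VectorField.lieBracket ℝ V W := by
  rw [← VectorField.mlieBracketWithin_univ, VectorField.mlieBracketWithin_eq_lieBracketWithin]
  exact VectorField.lieBracketWithin_univ

/-! ### Vector fields, `dt` and Lie brackets in bundle coordinates. -/

section Charts

variable {E : Type*} [NormedAddCommGroup E] [NormedSpace ℝ E]
variable {Q : Type*} [TopologicalSpace Q] [ChartedSpace (ℝ × E) Q]
variable {π : Q → ℝ} {φ : OpenPartialHomeomorph Q (ℝ × E)} {y : ℝ × E}

theorem IsBundleChart.mdifferentiable (hφ : IsBundleChart π φ) :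
    φ.MDifferentiable 𝓘(ℝ, ℝ × E) 𝓘(ℝ, ℝ × E) :=
  ⟨(contMDiffOn_of_mem_maximalAtlas hφ.smooth).mdifferentiableOn (by simp),
    (contMDiffOn_symm_of_mem_maximalAtlas hφ.smooth).mdifferentiableOn (by simp)⟩

theorem IsBundleChart.chartDiff_comp_chartSymmDiff (hφ : IsBundleChart π φ) (hy : y ∈ φ.target) :
    chartDiff φ y ∘L chartSymmDiff φ y = ContinuousLinearMap.id ℝ (ℝ × E) :=
  hφ.mdifferentiable.comp_symm_deriv hy

theorem IsBundleChart.chartSymmDiff_comp_chartDiff (hφ : IsBundleChart π φ) (hy : y ∈ φ.target) :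
    chartSymmDiff φ y ∘L chartDiff φ y = ContinuousLinearMap.id ℝ _ := by
  have h := hφ.mdifferentiable.symm_comp_deriv (φ.map_target hy)
  -- `h` has base point `φ (φ.symm y)`, on which the type of the derivative depends; ascribing both
  -- sides to maps of `ℝ × E` allows `y` to be substituted.
  have key : ∀ z, z = y →
      (mfderiv 𝓘(ℝ, ℝ × E) 𝓘(ℝ, ℝ × E) φ.symm z : ℝ × E →L[ℝ] ℝ × E)
        = (mfderiv 𝓘(ℝ, ℝ × E) 𝓘(ℝ, ℝ × E) φ.symm y : ℝ × E →L[ℝ] ℝ × E) := by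
    rintro z rfl; rfl
  exact (congrArg (fun T : ℝ × E →L[ℝ] ℝ × E => T ∘L (chartDiff φ y : ℝ × E →L[ℝ] ℝ × E))
    (key _ (φ.right_inv hy))).symm.trans h

theorem IsBundleChart.chartDiff_chartSymmDiff (hφ : IsBundleChart π φ) (hy : y ∈ φ.target)
    (v : ℝ × E) : chartDiff φ y (chartSymmDiff φ y v) = v :=
  congrArg (fun T : ℝ × E →L[ℝ] ℝ × E => T v) (hφ.chartDiff_comp_chartSymmDiff hy)

theorem IsBundleChart.isInvertible_mfderiv_symm (hφ : IsBundleChart π φ) (hy : y ∈ φ.target) :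
    (mfderiv 𝓘(ℝ, ℝ × E) 𝓘(ℝ, ℝ × E) φ.symm y).IsInvertible :=
  .of_inverse (g := chartDiff φ y) (hφ.chartSymmDiff_comp_chartDiff hy)
    (hφ.chartDiff_comp_chartSymmDiff hy)

/-- The pullback applies the inverse of `chartSymmDiff`, which is `chartDiff`. Smoothness and
bracket naturality of pullbacks thereby pass to `coordField`. -/
theorem IsBundleChart.mpullback_eq_coordField (hφ : IsBundleChart π φ) (u : VField E Q)
    (hy : y ∈ φ.target) :
    VectorField.mpullback 𝓘(ℝ, ℝ × E) 𝓘(ℝ, ℝ × E) φ.symm u y = coordField φ u y := by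
  exact congrArg (fun T : ℝ × E →L[ℝ] ℝ × E => T (u (φ.symm y)))
    (ContinuousLinearMap.inverse_eq (f := chartSymmDiff φ y) (g := chartDiff φ y)
      (hφ.chartSymmDiff_comp_chartDiff hy) (hφ.chartDiff_comp_chartSymmDiff hy))

/-- In bundle coordinates the form `dt` is the projection to the first coordinate. -/
theorem IsBundleChart.dt_apply (hφ : IsBundleChart π φ) (hy : y ∈ φ.target)
    (v : TangentSpace 𝓘(ℝ, ℝ × E) (φ.symm y)) :
    dt (E := E) π (φ.symm y) v = (chartDiff φ y v).1 := by
  have hs := φ.map_target hy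
  have h1 : HasMFDerivAt 𝓘(ℝ, ℝ × E) 𝓘(ℝ, ℝ) (fun q => (φ q).1) (φ.symm y)
      ((ContinuousLinearMap.fst ℝ ℝ E) ∘L chartDiff φ y) :=
    (ContinuousLinearMap.fst ℝ ℝ E).hasMFDerivAt.comp (φ.symm y)
      (hφ.mdifferentiable.mdifferentiableAt hs).hasMFDerivAt
  have h2 := h1.congr_of_eventuallyEq (f₁ := π)
    (Filter.eventually_of_mem (φ.open_source.mem_nhds hs) fun q hq => (hφ.fst_eq q hq).symm)
  exact congrArg (fun T : ℝ × E →L[ℝ] ℝ => T v) h2.mfderiv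

theorem IsBundleChart.dt_chartSymmDiff (hφ : IsBundleChart π φ) (hy : y ∈ φ.target)
    (v : ℝ × E) : dt (E := E) π (φ.symm y) (chartSymmDiff φ y v) = v.1 := by
  rw [hφ.dt_apply hy, hφ.chartDiff_chartSymmDiff hy]

theorem IsBundleChart.coordField_fst (hφ : IsBundleChart π φ) (hy : y ∈ φ.target)
    (u : VField E Q) : (coordField φ u y).1 = dt (E := E) π (φ.symm y) (u (φ.symm y)) :=
  (hφ.dt_apply hy _).symm

variable [IsManifold 𝓘(ℝ, ℝ × E) ∞ Q] [FiniteDimensional ℝ E]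

theorem IsBundleChart.contDiffOn_coordField (hφ : IsBundleChart π φ) {u : VField E Q}
    (hu : SmoothField u) : ContDiffOn ℝ ∞ (coordField φ u) φ.target := by
  have : CompleteSpace (ℝ × E) := FiniteDimensional.complete ℝ _
  have h : ∀ y ∈ φ.target, ContDiffAt ℝ ∞
      (VectorField.mpullback 𝓘(ℝ, ℝ × E) 𝓘(ℝ, ℝ × E) φ.symm u : ℝ × E → ℝ × E) y := fun y hy =>
    contMDiffAt_vectorSpace_iff_contDiffAt.1
      (ContMDiffAt.mpullback_vectorField_preimage (n := ∞) (hu _)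
        (contMDiffAt_symm_of_mem_maximalAtlas hφ.smooth hy)
        (hφ.isInvertible_mfderiv_symm hy) (by simp))
  exact fun y hy => (h y hy).contDiffWithinAt.congr
    (fun z hz => (hφ.mpullback_eq_coordField u hz).symm) (hφ.mpullback_eq_coordField u hy).symm

theorem IsBundleChart.differentiableAt_coordField (hφ : IsBundleChart π φ) {u : VField E Q}
    (hu : SmoothField u) (hy : y ∈ φ.target) : DifferentiableAt ℝ (coordField φ u) y :=
  ((hφ.contDiffOn_coordField hu).contDiffAt (φ.open_target.mem_nhds hy)).differentiableAt
    (by simp)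

/-- The coordinate expression of the Lie bracket of vector fields. -/
theorem IsBundleChart.coordField_mlieBracket (hφ : IsBundleChart π φ) {u v : VField E Q}
    (hu : SmoothField u) (hv : SmoothField v) (hy : y ∈ φ.target) :
    coordField φ (VectorField.mlieBracket 𝓘(ℝ, ℝ × E) u v) y =
      fderiv ℝ (coordField φ v) y (coordField φ u y)
        - fderiv ℝ (coordField φ u) y (coordField φ v y) := by
  have : CompleteSpace (ℝ × E) := FiniteDimensional.complete ℝ _
  have : IsManifold 𝓘(ℝ, ℝ × E) (minSmoothness ℝ 2) Q := by
    rw [minSmoothness_of_isRCLikeNormedField]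
    exact IsManifold.of_le (n := ∞) ENat.LEInfty.out
  have hn : minSmoothness ℝ 2 ≤ (∞ : ℕ∞ω) := by
    rw [minSmoothness_of_isRCLikeNormedField]
    exact ENat.LEInfty.out
  have h := VectorField.mpullback_mlieBracket (hu.mdifferentiableAt _) (hv.mdifferentiableAt _)
    (contMDiffAt_symm_of_mem_maximalAtlas hφ.smooth hy) hn
  rw [hφ.mpullback_eq_coordField _ hy] at h
  have ev : ∀ w : VField E Q, VectorField.mpullback 𝓘(ℝ, ℝ × E) 𝓘(ℝ, ℝ × E) φ.symm w
      =ᶠ[nhds y] coordField φ w := fun w =>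
    Filter.eventually_of_mem (φ.open_target.mem_nhds hy) fun z hz =>
      hφ.mpullback_eq_coordField w hz
  rw [(ev u).mlieBracket_vectorField_eq (ev v)] at h
  exact h.trans (congrFun (mlieBracket_eq_lieBracket (coordField φ u) (coordField φ v)) y)

end Charts

/-! ### Calculus of the canonical bracket in holonomic coordinates. -/

section PhaseSpace

variable {E : Type*} [NormedAddCommGroup E] [NormedSpace ℝ E]

/-- The differential of the function `p_i X^i` of the holonomic coordinates. -/
theorem fderiv_pairing {X : ℝ × E → ℝ × E} {w : PhaseModel E}
    (hX : DifferentiableAt ℝ X w.1) (v : PhaseModel E) :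
    fderiv ℝ (fun w' : PhaseModel E => w'.2 (X w'.1).2) w v
      = v.2 (X w.1).2 + w.2 (fderiv ℝ X w.1 v.1).2 := by
  have h1 : HasFDerivAt (fun w' : PhaseModel E => (X w'.1).2)
      ((ContinuousLinearMap.snd ℝ ℝ E) ∘L (fderiv ℝ X w.1 ∘L
        ContinuousLinearMap.fst ℝ (ℝ × E) (E →L[ℝ] ℝ))) w :=
    (ContinuousLinearMap.snd ℝ ℝ E).hasFDerivAt.comp w
      (hX.hasFDerivAt.comp w hasFDerivAt_fst)
  have h2 : HasFDerivAt (fun w' : PhaseModel E => w'.2)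
      (ContinuousLinearMap.snd ℝ (ℝ × E) (E →L[ℝ] ℝ)) w := hasFDerivAt_snd
  rw [(h2.clm_apply h1).fderiv]
  simp [add_comm]

theorem differentiableAt_pairing {X : ℝ × E → ℝ × E} {w : PhaseModel E}
    (hX : DifferentiableAt ℝ X w.1) :
    DifferentiableAt ℝ (fun w' : PhaseModel E => w'.2 (X w'.1).2) w :=
  differentiableAt_snd.clm_apply (hX.comp w differentiableAt_fst).snd

theorem dPosition_apply (F : PhaseModel E → ℝ) (w : PhaseModel E) (e : E) :
    dPosition F w e = fderiv ℝ F w ((0, e), 0) := rfl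

/-- The Hamiltonian vector field of `p_i X^i` is `X^i ∂_i - p_j ∂_i X^j ∂^i`. When `X` has no `∂_t`
component this is its canonical lift, so Poisson centrality becomes invariance under lifts. -/
theorem coordBracket_pairing_left {X : ℝ × E → ℝ × E} {w : PhaseModel E}
    (hX : DifferentiableAt ℝ X w.1) (F : PhaseModel E → ℝ) :
    coordBracket (fun w' : PhaseModel E => w'.2 (X w'.1).2) F w
      = fderiv ℝ F w ((0, (X w.1).2),
          -(((w.2 ∘L ContinuousLinearMap.snd ℝ ℝ E) ∘L fderiv ℝ X w.1) ∘L
            ContinuousLinearMap.inr ℝ ℝ E)) := by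
  have h : dPosition (fun w' : PhaseModel E => w'.2 (X w'.1).2) w
      = ((w.2 ∘L ContinuousLinearMap.snd ℝ ℝ E) ∘L fderiv ℝ X w.1) ∘L
          ContinuousLinearMap.inr ℝ ℝ E := by
    ext e
    rw [dPosition_apply, fderiv_pairing hX]
    simp
  rw [coordBracket, fderiv_pairing hX, h, sub_eq_iff_eq_add, ← map_add]
  simp [dPosition_apply]

/-- The canonical bracket of `p_i X^i` and `p_i Y^i`, for vector fields without `∂_t` component. -/
theorem coordBracket_pairing {X Y : ℝ × E → ℝ × E} {w : PhaseModel E}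
    (hX : DifferentiableAt ℝ X w.1) (hY : DifferentiableAt ℝ Y w.1)
    (hX0 : (X w.1).1 = 0) (hY0 : (Y w.1).1 = 0) :
    coordBracket (fun w' : PhaseModel E => w'.2 (X w'.1).2)
        (fun w' : PhaseModel E => w'.2 (Y w'.1).2) w
      = w.2 (fderiv ℝ Y w.1 (X w.1) - fderiv ℝ X w.1 (Y w.1)).2 := by
  have eX : ((0 : ℝ), (X w.1).2) = X w.1 := Prod.ext hX0.symm rfl
  have eY : ((0 : ℝ), (Y w.1).2) = Y w.1 := Prod.ext hY0.symm rfl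
  rw [coordBracket_pairing_left hX, fderiv_pairing hY]
  simp [eX, eY]
  ring

theorem isOpen_phaseTarget {Q : Type*} [TopologicalSpace Q]
    (φ : OpenPartialHomeomorph Q (ℝ × E)) : IsOpen (phaseTarget φ) :=
  φ.open_target.prod isOpen_univ

end PhaseSpace

/-! ### Hamiltonian forms `H_Γ - f dt`: smoothness, symmetries, and the frame criterion. -/

section Forms

variable {E : Type*} [NormedAddCommGroup E] [NormedSpace ℝ E]
variable {Q : Type*} [TopologicalSpace Q] [ChartedSpace (ℝ × E) Q]
variable {π : Q → ℝ} {φ : OpenPartialHomeomorph Q (ℝ × E)}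

theorem IsBundleChart.coordField_fst_of_vertical (hφ : IsBundleChart π φ) {u : VField E Q}
    (hu : ∀ q, u q ∈ VertSpace (E := E) π q) {y : ℝ × E} (hy : y ∈ φ.target) :
    (coordField φ u y).1 = 0 := by
  rw [hφ.coordField_fst hy]
  exact hu _

variable [IsManifold 𝓘(ℝ, ℝ × E) ∞ Q]

theorem shiftedFrameForm_apply (Γ : ReferenceFrame E π) (f : VStar E π → ℝ) (x : VStar E π)
    (v : TangentSpace 𝓘(ℝ, ℝ × E) x.1) :
    shiftedFrameForm Γ f x v = x.2 (Γ.vert x.1 v) - f x * dt (E := E) π x.1 v := rfl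

theorem ReferenceFrame.vert_coe (Γ : ReferenceFrame E π) (q : Q)
    (v : TangentSpace 𝓘(ℝ, ℝ × E) q) :
    (Γ.vert q v : TangentSpace 𝓘(ℝ, ℝ × E) q) = v - dt (E := E) π q v • Γ.field q := rfl

/-- The coordinate expression `p_i dq^i - (p_i Γ^i + f) dt` of `H_Γ - f dt`. -/
theorem IsBundleChart.coordForm_shiftedFrameForm (hφ : IsBundleChart π φ)
    (Γ : ReferenceFrame E π) (f : VStar E π → ℝ) {w : PhaseModel E} (hw : w ∈ phaseTarget φ) :
    coordForm π (shiftedFrameForm Γ f) φ w =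
      (w.2 ∘L ContinuousLinearMap.snd ℝ ℝ E) ∘L ContinuousLinearMap.fst ℝ (ℝ × E) (E →L[ℝ] ℝ)
      - (w.2 (coordField φ Γ.field w.1).2 + f (ofCoords π φ w)) •
        (ContinuousLinearMap.fst ℝ ℝ E ∘L ContinuousLinearMap.fst ℝ (ℝ × E) (E →L[ℝ] ℝ)) := by
  have hy : w.1 ∈ φ.target := hw.1
  refine ContinuousLinearMap.ext fun v => ?_
  have h1 : coordForm π (shiftedFrameForm Γ f) φ w v
      = w.2 (chartDiff φ w.1 (chartSymmDiff φ w.1 v.1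
          - dt (E := E) π (φ.symm w.1) (chartSymmDiff φ w.1 v.1) • Γ.field (φ.symm w.1))).2
        - f (ofCoords π φ w) * dt (E := E) π (φ.symm w.1) (chartSymmDiff φ w.1 v.1) := rfl
  rw [h1, map_sub, map_smul, hφ.chartDiff_chartSymmDiff hy, hφ.dt_chartSymmDiff hy]
  change w.2 (v.1.2 - v.1.1 • (coordField φ Γ.field w.1).2) - f (ofCoords π φ w) * v.1.1
    = w.2 v.1.2 - (w.2 (coordField φ Γ.field w.1).2 + f (ofCoords π φ w)) * v.1.1
  rw [map_sub, map_smul, smul_eq_mul]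
  ring

theorem IsBundleChart.contDiffOn_coordForm_shiftedFrameForm [FiniteDimensional ℝ E]
    (hφ : IsBundleChart π φ) (Γ : ReferenceFrame E π) {f : VStar E π → ℝ}
    (hf : ContDiffOn ℝ ∞ (fun w => f (ofCoords π φ w)) (phaseTarget φ)) :
    ContDiffOn ℝ ∞ (coordForm π (shiftedFrameForm Γ f) φ) (phaseTarget φ) := by
  refine ContDiffOn.congr ?_ fun w hw => hφ.coordForm_shiftedFrameForm Γ f hw
  have hΓ : ContDiffOn ℝ ∞ (fun w : PhaseModel E => coordField φ Γ.field w.1)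
      (phaseTarget φ) :=
    (hφ.contDiffOn_coordField Γ.smooth).comp contDiffOn_fst fun w hw => hw.1
  have hp : ContDiffOn ℝ ∞ (fun w : PhaseModel E => w.2) (phaseTarget φ) := contDiffOn_snd
  exact ((hp.clm_comp contDiffOn_const).clm_comp contDiffOn_const).sub
    (((hp.clm_apply hΓ.snd).add hf).smul contDiffOn_const)

/-- `H_Γ - f dt` is a Hamiltonian form if `f` is smooth in holonomic coordinates. -/
theorem isHamiltonianForm_shiftedFrameForm [FiniteDimensional ℝ E] (Γ : ReferenceFrame E π)
    {f : VStar E π → ℝ} (hf : ∀ φ : OpenPartialHomeomorph Q (ℝ × E), IsBundleChart π φ →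
      ContDiffOn ℝ ∞ (fun w => f (ofCoords π φ w)) (phaseTarget φ)) :
    IsHamiltonianForm π (shiftedFrameForm Γ f) where
  isSection x v := by
    have hv : dt (E := E) π x.1 v = 0 := v.2
    have h : Γ.vert x.1 v = v := Subtype.ext (by rw [Γ.vert_coe, hv, zero_smul, sub_zero])
    rw [shiftedFrameForm_apply, h, hv, mul_zero, sub_zero]
  smooth φ hφ := hφ.contDiffOn_coordForm_shiftedFrameForm Γ (hf φ hφ)

/-- The Lie derivative of `H_Γ - f dt` along the canonical lift of a vertical vector field which
commutes with `Γ` vanishes if `f` is invariant under the lift. -/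
theorem IsBundleChart.lieDerivForm_shiftedFrameForm [FiniteDimensional ℝ E]
    (hφ : IsBundleChart π φ) (Γ : ReferenceFrame E π) {f : VStar E π → ℝ}
    (hf : ContDiffOn ℝ ∞ (fun w => f (ofCoords π φ w)) (phaseTarget φ)) {u : VField E Q}
    (hu : SmoothField u) (hv : ∀ q, u q ∈ VertSpace (E := E) π q)
    (hΓ : VectorField.mlieBracket 𝓘(ℝ, ℝ × E) Γ.field u = 0) {w : PhaseModel E}
    (hw : w ∈ phaseTarget φ)
    (hfu : fderiv ℝ (fun w' => f (ofCoords π φ w')) w (coordLift φ u w) = 0) :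
    lieDerivForm (coordLift φ u) (coordForm π (shiftedFrameForm Γ f) φ) w = 0 := by
  have hy : w.1 ∈ φ.target := hw.1
  have hnhds : phaseTarget φ ∈ nhds w := (isOpen_phaseTarget φ).mem_nhds hw
  set U := coordField φ u with hU
  set G := coordField φ Γ.field
  have dU : DifferentiableAt ℝ U w.1 := hφ.differentiableAt_coordField hu hy
  have dG : DifferentiableAt ℝ G w.1 := hφ.differentiableAt_coordField Γ.smooth hy
  have dF : DifferentiableAt ℝ (fun w' => f (ofCoords π φ w')) w :=
    (hf.contDiffAt hnhds).differentiableAt (by simp)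
  have G1 : (1, (G w.1).2) = G w.1 :=
    Prod.ext ((hφ.coordField_fst hy Γ.field).trans (Γ.dt_eq _)).symm rfl
  -- The `∂_t` component of `u` vanishes on the whole chart, hence so do its derivatives.
  have DU0 : ∀ z, (fderiv ℝ U w.1 z).1 = 0 := by
    intro z
    have h1 : (fun y => (U y).1) =ᶠ[nhds w.1] fun _ => (0 : ℝ) :=
      Filter.eventually_of_mem (φ.open_target.mem_nhds hy) fun y hy' =>
        hφ.coordField_fst_of_vertical hv hy'
    have h2 := h1.fderiv_eq (𝕜 := ℝ)
    rw [fderiv.fst dU] at h2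
    simpa using congrArg (fun T : ℝ × E →L[ℝ] ℝ => T z) h2
  have comm : fderiv ℝ U w.1 (G w.1) = fderiv ℝ G w.1 (U w.1) := by
    have h := hφ.coordField_mlieBracket Γ.smooth hu hy
    rw [hΓ] at h
    have h0 : coordField φ (0 : VField E Q) w.1 = 0 := map_zero (chartDiff φ w.1)
    rw [h0] at h
    exact (sub_eq_zero.1 h.symm)
  have dX : DifferentiableAt ℝ (coordLift φ u) w := by
    -- The momentum part of the lift contains `∂_i u^j`, so second derivatives of `u` are needed.
    have d2U : DifferentiableAt ℝ (fderiv ℝ U) w.1 :=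
      (((hφ.contDiffOn_coordField hu).contDiffAt (φ.open_target.mem_nhds hy)).fderiv_right
        (m := ∞) (by simp)).differentiableAt (by simp)
    exact (dU.comp w differentiableAt_fst).prodMk
      (((differentiableAt_snd.clm_comp (differentiableAt_const _)).clm_comp
        (d2U.comp w differentiableAt_fst)).clm_comp (differentiableAt_const _)).neg
  have DX : ∀ v, (fderiv ℝ (coordLift φ u) w v).1 = fderiv ℝ U w.1 v.1 := by
    intro v
    have h : HasFDerivAt (fun w' : PhaseModel E => U w'.1)
        (fderiv ℝ U w.1 ∘L ContinuousLinearMap.fst ℝ (ℝ × E) (E →L[ℝ] ℝ)) w :=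
      dU.hasFDerivAt.comp w hasFDerivAt_fst
    have h' : fderiv ℝ (fun w' => (coordLift φ u w').1) w
        = fderiv ℝ U w.1 ∘L ContinuousLinearMap.fst ℝ (ℝ × E) (E →L[ℝ] ℝ) := h.fderiv
    rw [fderiv.fst dX] at h'
    exact congrArg (fun T : PhaseModel E →L[ℝ] ℝ × E => T v) h'
  have dη : DifferentiableAt ℝ (coordForm π (shiftedFrameForm Γ f) φ) w :=
    ((hφ.contDiffOn_coordForm_shiftedFrameForm Γ hf).contDiffAt hnhds).differentiableAt
      (by simp)
  refine ContinuousLinearMap.ext fun v => ?_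
  have Dη : fderiv ℝ (coordForm π (shiftedFrameForm Γ f) φ) w (coordLift φ u w) v
      = -w.2 (fderiv ℝ U w.1 (0, v.1.2)).2
        - (-w.2 (fderiv ℝ U w.1 (0, (G w.1).2)).2 + w.2 (fderiv ℝ G w.1 (U w.1)).2) * v.1.1 := by
    have h1 : fderiv ℝ (coordForm π (shiftedFrameForm Γ f) φ) w (coordLift φ u w) v
        = fderiv ℝ (fun w' => coordForm π (shiftedFrameForm Γ f) φ w' v) w (coordLift φ u w) := by
      rw [fderiv_clm_apply dη (differentiableAt_const v)]
      simp
    -- With `v` frozen, `p_i v^i` is a pairing with a constant vector field, so `fderiv_pairing`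
    -- handles both momentum terms.
    have h2 : (fun w' => coordForm π (shiftedFrameForm Γ f) φ w' v) =ᶠ[nhds w]
        fun w' => w'.2 ((fun _ => v.1) w'.1).2
          - (w'.2 (G w'.1).2 + f (ofCoords π φ w')) * v.1.1 :=
      Filter.eventually_of_mem hnhds fun w' hw' => by
        change coordForm π (shiftedFrameForm Γ f) φ w' v = _
        rw [hφ.coordForm_shiftedFrameForm Γ f hw']
        rfl
    have d1 : DifferentiableAt ℝ (fun w' : PhaseModel E => w'.2 ((fun _ => v.1) w'.1).2) w :=
      differentiableAt_pairing (X := fun _ => v.1) (differentiableAt_const _)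
    have d2 := differentiableAt_pairing (w := w) dG
    have h3 : HasFDerivAt (fun w' : PhaseModel E => w'.2 ((fun _ => v.1) w'.1).2
        - (w'.2 (G w'.1).2 + f (ofCoords π φ w')) * v.1.1) _ w :=
      d1.hasFDerivAt.sub ((d2.hasFDerivAt.add dF.hasFDerivAt).mul_const v.1.1)
    rw [h1, h2.fderiv_eq, h3.fderiv, sub_apply, smul_apply, add_apply, hfu,
      fderiv_pairing (X := fun _ => v.1) (differentiableAt_const _), fderiv_pairing dG]
    simp [coordLift, ← hU]
    ring
  have ηX : coordForm π (shiftedFrameForm Γ f) φ w (fderiv ℝ (coordLift φ u) w v)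
      = w.2 (fderiv ℝ U w.1 v.1).2 := by
    rw [hφ.coordForm_shiftedFrameForm Γ f hw]
    simp [DX, DU0]
  -- Separating `∂_t u` from the `q`-derivatives: the latter cancel against the momentum part of the
  -- lift, and `[Γ, u] = 0` removes the remaining `∂_t u` terms.
  have split1 : fderiv ℝ U w.1 v.1
      = v.1.1 • fderiv ℝ U w.1 (1, 0) + fderiv ℝ U w.1 (0, v.1.2) := by
    rw [← map_smul, ← map_add]
    simp
  have split2 : fderiv ℝ G w.1 (U w.1)
      = fderiv ℝ U w.1 (1, 0) + fderiv ℝ U w.1 (0, (G w.1).2) := by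
    rw [← comm, ← map_add]
    simp [G1]
  change fderiv ℝ (coordForm π (shiftedFrameForm Γ f) φ) w (coordLift φ u w) v
    + coordForm π (shiftedFrameForm Γ f) φ w (fderiv ℝ (coordLift φ u) w v) = 0
  rw [Dη, ηX, split1, split2]
  simp only [Prod.snd_add, Prod.smul_snd, map_add, map_smul, smul_eq_mul]
  ring

/-- `H_Γ - f dt` is a frame Hamiltonian form exactly when `f` is a Noether current. -/
theorem isFrameForm_shiftedFrameForm_iff (Γ : ReferenceFrame E π) (f : VStar E π → ℝ) :
    IsFrameForm π (shiftedFrameForm Γ f) ↔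
      ∃ (v : VField E Q) (hv : ∀ q, v q ∈ VertSpace (E := E) π q),
        SmoothField v ∧ f = current v hv := by
  constructor
  · rintro ⟨Γ', h⟩
    have hv : ∀ q, (Γ'.field - Γ.field) q ∈ VertSpace (E := E) π q := fun q => by
      change dt (E := E) π q (Γ'.field q - Γ.field q) = 0
      rw [map_sub, Γ'.dt_eq, Γ.dt_eq, sub_self]
    refine ⟨Γ'.field - Γ.field, hv, Γ'.smooth.sub_section Γ.smooth, funext fun x => ?_⟩
    -- Evaluation on `Γ` isolates `f`: the left side is `-f`, the right side is minus the current of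
    -- `Γ' - Γ`.
    have hx : shiftedFrameForm Γ f x (Γ.field x.1) = frameForm Γ' x (Γ.field x.1) := by rw [h]
    have h1 : Γ.vert x.1 (Γ.field x.1) = 0 := Subtype.ext (by
      rw [Γ.vert_coe, Γ.dt_eq, one_smul, sub_self]; rfl)
    have h2 : Γ'.vert x.1 (Γ.field x.1) = -⟨(Γ'.field - Γ.field) x.1, hv x.1⟩ :=
      Subtype.ext (by
        rw [Γ'.vert_coe, Γ.dt_eq, one_smul]
        exact (neg_sub _ _).symm)
    rw [shiftedFrameForm_apply, h1, Γ.dt_eq, map_zero, mul_one, zero_sub] at hx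
    have hx' : frameForm Γ' x (Γ.field x.1) = x.2 (Γ'.vert x.1 (Γ.field x.1)) := rfl
    rw [hx', h2, map_neg] at hx
    exact neg_injective hx
  · rintro ⟨v, hv, hs, rfl⟩
    have hv' : ∀ q, dt (E := E) π q (v q) = 0 := hv
    let Γ' : ReferenceFrame E π :=
      { field := Γ.field + v
        smooth := Γ.smooth.add_section hs
        dt_eq := fun q => by
          change dt (E := E) π q (Γ.field q + v q) = 1
          rw [map_add, Γ.dt_eq, hv', add_zero] }
    refine ⟨Γ', funext fun x => ContinuousLinearMap.ext fun z => ?_⟩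
    have h1 : Γ'.vert x.1 z = Γ.vert x.1 z - dt (E := E) π x.1 z • ⟨v x.1, hv x.1⟩ :=
      Subtype.ext (by
        change z - dt (E := E) π x.1 z • (Γ.field x.1 + v x.1)
          = z - dt (E := E) π x.1 z • Γ.field x.1 - dt (E := E) π x.1 z • v x.1
        rw [smul_add, sub_sub])
    change x.2 (Γ.vert x.1 z) - current v hv x * dt (E := E) π x.1 z = x.2 (Γ'.vert x.1 z)
    rw [h1, map_sub, map_smul, smul_eq_mul, mul_comm]
    rfl

end Forms

/-! ### Noether currents, central polynomials, and the scalar example. -/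

section Currents

variable {E : Type*} [NormedAddCommGroup E] [NormedSpace ℝ E] [FiniteDimensional ℝ E]
variable {Q : Type*} [TopologicalSpace Q] [ChartedSpace (ℝ × E) Q]
  [IsManifold 𝓘(ℝ, ℝ × E) ∞ Q]
variable {π : Q → ℝ} (𝒜 : VerticalLieAlgebra E π)

omit [FiniteDimensional ℝ E] [IsManifold 𝓘(ℝ, ℝ × E) ∞ Q] in
-- Hahn–Banach on the model space `ℝ × E`, followed by restriction to vertical vectors.
theorem exists_dual_ne_zero {q : Q} {v : VertSpace (E := E) π q} (hv : v ≠ 0) :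
    ∃ α : VertSpace (E := E) π q →L[ℝ] ℝ, α v ≠ 0 := by
  have hv' : (show ℝ × E from v.1) ≠ 0 := fun h => hv (Subtype.ext h)
  obtain ⟨g, hg⟩ := SeparatingDual.exists_ne_zero (R := ℝ) hv'
  exact ⟨(show TangentSpace 𝓘(ℝ, ℝ × E) q →L[ℝ] ℝ from g) ∘L
    (VertSpace (E := E) π q).subtypeL, hg⟩

omit [FiniteDimensional ℝ E] in
theorem VerticalLieAlgebra.J_injective : Function.Injective 𝒜.J := by
  intro u v h
  refine Subtype.ext (funext fun q => ?_)
  by_contra hne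
  have hd : (⟨u.1 q, 𝒜.vertical u.1 u.2 q⟩ : VertSpace (E := E) π q)
      - ⟨v.1 q, 𝒜.vertical v.1 v.2 q⟩ ≠ 0 := fun h0 =>
    hne (congrArg Subtype.val (sub_eq_zero.1 h0))
  obtain ⟨α, hα⟩ := exists_dual_ne_zero hd
  refine hα ?_
  rw [map_sub]
  exact sub_eq_zero.2 (congrFun h ⟨q, α⟩)

theorem VerticalLieAlgebra.isPoissonBracket_J (u v : 𝒜.carrier) :
    IsPoissonBracket π (𝒜.J u) (𝒜.J v) (𝒜.J ⁅u, v⁆) := by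
  intro φ hφ w hw
  have hy : w.1 ∈ φ.target := hw.1
  -- In holonomic coordinates `J_u` is definitionally `p_i u^i`, so the bracket of pairings applies
  -- directly.
  refine (coordBracket_pairing (X := coordField φ u.1) (Y := coordField φ v.1)
    (hφ.differentiableAt_coordField (𝒜.smooth _ u.2) hy)
    (hφ.differentiableAt_coordField (𝒜.smooth _ v.2) hy)
    (hφ.coordField_fst_of_vertical (𝒜.vertical _ u.2) hy)
    (hφ.coordField_fst_of_vertical (𝒜.vertical _ v.2) hy)).trans ?_
  rw [← hφ.coordField_mlieBracket (𝒜.smooth _ u.2) (𝒜.smooth _ v.2) hy]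
  rfl

variable {𝒜} in
/-- Polynomials in the currents are smooth in holonomic coordinates. -/
theorem VerticalLieAlgebra.contDiffOn_of_mem_adjoin {f : VStar E π → ℝ}
    (hf : f ∈ Algebra.adjoin ℝ (Set.range 𝒜.J)) {φ : OpenPartialHomeomorph Q (ℝ × E)}
    (hφ : IsBundleChart π φ) :
    ContDiffOn ℝ ∞ (fun w => f (ofCoords π φ w)) (phaseTarget φ) := by
  induction hf using Algebra.adjoin_induction with
  | mem f hf =>
    obtain ⟨u, rfl⟩ := hf
    exact contDiffOn_snd.clm_apply
      ((hφ.contDiffOn_coordField (𝒜.smooth _ u.2)).comp contDiffOn_fst fun w hw => hw.1).snd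
  | algebraMap r => exact contDiffOn_const
  | add f g _ _ hf hg => exact hf.add hg
  | mul f g _ _ hf hg => exact hf.mul hg

variable {𝒜} in
theorem VerticalLieAlgebra.IsPoissonCentral.isHamiltonianForm {f : VStar E π → ℝ}
    (hf : 𝒜.IsPoissonCentral f) (Γ : ReferenceFrame E π) :
    IsHamiltonianForm π (shiftedFrameForm Γ f) :=
  isHamiltonianForm_shiftedFrameForm Γ fun _ hφ => contDiffOn_of_mem_adjoin hf.1 hφ

variable {𝒜} in
theorem VerticalLieAlgebra.IsPoissonCentral.isGaugeSymmetry {f : VStar E π → ℝ}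
    (hf : 𝒜.IsPoissonCentral f) (Γ : ReferenceFrame E π) {u : VField E Q} (hu : u ∈ 𝒜.carrier)
    (hΓ : VectorField.mlieBracket 𝓘(ℝ, ℝ × E) Γ.field u = 0) :
    IsGaugeSymmetry π (shiftedFrameForm Γ f) u where
  smooth := 𝒜.smooth u hu
  const := ⟨0, 𝒜.vertical u hu⟩
  invariant φ hφ w hw := by
    have hy : w.1 ∈ φ.target := hw.1
    refine hφ.lieDerivForm_shiftedFrameForm Γ (contDiffOn_of_mem_adjoin hf.1 hφ)
      (𝒜.smooth u hu) (𝒜.vertical u hu) hΓ hw ?_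
    have h := (coordBracket_pairing_left
      (hφ.differentiableAt_coordField (𝒜.smooth _ hu) hy) _).symm.trans (hf.2 ⟨u, hu⟩ φ hφ w hw)
    -- Verticality identifies the canonical lift of `u` with the Hamiltonian vector field of `J_u`.
    have e : coordField φ u w.1 = (0, (coordField φ u w.1).2) :=
      Prod.ext (hφ.coordField_fst_of_vertical (𝒜.vertical _ hu) hy) rfl
    rw [coordLift, e]
    exact h

omit [FiniteDimensional ℝ E] in
theorem VerticalLieAlgebra.isPoissonCentral_one : 𝒜.IsPoissonCentral 1 := by
  refine ⟨one_mem _, fun u φ _ w _ => ?_⟩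
  have h : (fun w' : PhaseModel E => (1 : VStar E π → ℝ) (ofCoords π φ w')) = fun _ => 1 := rfl
  rw [h]
  simp only [coordBracket, dPosition, fderiv_fun_const, Pi.zero_apply,
    ContinuousLinearMap.zero_comp, zero_apply, sub_zero]
  exact map_zero _

theorem VerticalLieAlgebra.one_mem_symmetrization : (1, 1) ∈ 𝒜.symmetrization :=
  -- The generator with `u = 0`, `n = 0`: both zeroth powers are `1`.
  Submodule.subset_span ⟨(0, 0), by simp⟩

omit [FiniteDimensional ℝ E] in
/-- The form `H_Γ - dt` is not a frame Hamiltonian form: it does not vanish at zero momenta. -/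
theorem not_isFrameForm_shiftedFrameForm_one [Nonempty Q] (Γ : ReferenceFrame E π) :
    ¬ IsFrameForm π (shiftedFrameForm Γ 1) := by
  intro h
  obtain ⟨v, hv, -, h1⟩ := (isFrameForm_shiftedFrameForm_iff Γ 1).1 h
  -- At the zero covector any current is `0`, while `f` is `1`.
  exact one_ne_zero (congrFun h1 ⟨Classical.arbitrary Q, 0⟩)

omit [FiniteDimensional ℝ E] [IsManifold 𝓘(ℝ, ℝ × E) ∞ Q] in
theorem IsSmoothFibreBundle.nonempty {M : Type*} [TopologicalSpace M] [ChartedSpace E M]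
    [Nonempty M] (hπ : IsSmoothFibreBundle (E := E) M π) : Nonempty Q := by
  obtain ⟨e, -⟩ := hπ 0
  -- The inverse trivialization is a total function, so any of its values is a point of `Q`.
  exact ⟨e.toOpenPartialHomeomorph.symm (0, Classical.arbitrary M)⟩

end Currents

end TimeMech

end

theorem mainTheorem10
    {E : Type*} [NormedAddCommGroup E] [NormedSpace ℝ E] [FiniteDimensional ℝ E]
    {Q : Type*} [TopologicalSpace Q] [T2Space Q] [SecondCountableTopology Q]
    [ChartedSpace (ℝ × E) Q] [IsManifold 𝓘(ℝ, ℝ × E) ∞ Q]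
    {M : Type*} [TopologicalSpace M] [ChartedSpace E M] [IsManifold 𝓘(ℝ, E) ∞ M] [Nonempty M]
    (π : Q → ℝ) (hπ : TimeMech.IsSmoothFibreBundle (E := E) M π)
    (𝒜 : TimeMech.VerticalLieAlgebra E π) (hfin : FiniteDimensional ℝ 𝒜.carrier)
    (Γ : TimeMech.ReferenceFrame E π)
    (hΓ : ∀ u ∈ 𝒜.carrier, VectorField.mlieBracket 𝓘(ℝ, ℝ × E) Γ.field u = 0) :
    -- the currents form a Lie algebra isomorphic to `𝒜` for the Poisson bracket
    (Function.Injective 𝒜.J ∧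
      ∀ u v : 𝒜.carrier, TimeMech.IsPoissonBracket π (𝒜.J u) (𝒜.J v) (𝒜.J ⁅u, v⁆)) ∧
    -- every central polynomial in the currents gives a Hamiltonian form with gauge symmetries `𝒜`
    (∀ f, 𝒜.IsPoissonCentral f →
      TimeMech.IsHamiltonianForm π (TimeMech.shiftedFrameForm Γ f) ∧
      ∀ u ∈ 𝒜.carrier, TimeMech.IsGaugeSymmetry π (TimeMech.shiftedFrameForm Γ f) u) ∧
    -- this form is a frame form only if the polynomial reduces to a Noether current
    (∀ f, 𝒜.IsPoissonCentral f →
      (TimeMech.IsFrameForm π (TimeMech.shiftedFrameForm Γ f) ↔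
        ∃ (v : TimeMech.VField E Q) (hv : ∀ q, v q ∈ TimeMech.VertSpace (E := E) π q),
          TimeMech.SmoothField v ∧ f = TimeMech.current v hv)) ∧
    -- there is a non-frame form `H_Γ - C dt` with `C` central in the enveloping algebra
    ∃ C ∈ Subalgebra.center ℝ (UniversalEnvelopingAlgebra ℝ 𝒜.carrier),
      ∃ f, (C, f) ∈ 𝒜.symmetrization ∧ 𝒜.IsPoissonCentral f ∧
        TimeMech.IsHamiltonianForm π (TimeMech.shiftedFrameForm Γ f) ∧
        ¬ TimeMech.IsFrameForm π (TimeMech.shiftedFrameForm Γ f) ∧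
        ∀ u ∈ 𝒜.carrier, TimeMech.IsGaugeSymmetry π (TimeMech.shiftedFrameForm Γ f) u := by
  have : Nonempty Q := hπ.nonempty
  have gauge : ∀ f, 𝒜.IsPoissonCentral f → ∀ u ∈ 𝒜.carrier,
      TimeMech.IsGaugeSymmetry π (TimeMech.shiftedFrameForm Γ f) u :=
    fun f hf u hu => hf.isGaugeSymmetry Γ hu (hΓ u hu)
  exact ⟨⟨𝒜.J_injective, 𝒜.isPoissonBracket_J⟩,
    fun f hf => ⟨hf.isHamiltonianForm Γ, gauge f hf⟩,
    fun f _ => TimeMech.isFrameForm_shiftedFrameForm_iff Γ f,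
    -- The scalar `1` works for every `𝒜`, even if the center contains nothing but scalars.
    1, one_mem _, 1, 𝒜.one_mem_symmetrization, 𝒜.isPoissonCentral_one,
    𝒜.isPoissonCentral_one.isHamiltonianForm Γ,
    TimeMech.not_isFrameForm_shiftedFrameForm_one Γ, gauge 1 𝒜.isPoissonCentral_one⟩
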